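/- Work on $\mathbb{R}^3$ with Cartesian coordinates $x^1,x^2,x^3$ and with differential polynomials over $\mathbb{R}$ in two functions $\varrho,a$, i.e. polynomials in the jet variables $\partial^\sigma\varrho,\partial^\sigma a$, $\sigma\in\mathbb{Z}_{\ge0}^3$, with total derivatives $\partial_i$. Let $P=P(\varrho,[a])$ be the Nambu-determinant Poisson bi-vector with components $P^{jk}=\varrho\sum_i\varepsilon^{ijk}\,\partial_i a$, i.e. $\{f,g\}_P=\varrho\cdot\det\bigl(\partial(a,f,g)/\partial(x^1,x^2,x^3)\bigr)$. Let $Q_{\gamma_3}$ be Kontsevich's tetrahedral flow, given by the combination of directed graphs $$Q_{\gamma_3}=1\cdot(0,1;\,2,4;\,2,5;\,2,3)-3\cdot\bigl((0,3;\,1,4;\,2,5;\,2,3)+(0,3;\,4,5;\,1,2;\,2,4)\bigr)$$ on sinks $0,1$ and internal vertices $2,3,4,5$; the successive pairs list the heads of the ordered (Left $\prec$ Right) outgoing edges of $2,3,4,5$. The bi-vector $Q_{\gamma_3}(P)$ is obtained by decorating each edge by an index in $\{1,2,3\}$, putting into every internal vertex the component of $P$ given by the indices on its two outgoing edges, differentiating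 the content of each vertex with respect to the indices on its incoming edges, multiplying, and summing over all indices, the indices on the edges into the sinks $0$ and $1$ being the bi-vector indices. Consider micro-graphs over one sink: directed graphs on one sink of in-degree $1$, three trident vertices, each with three ordered outgoing edges and carrying $\varrho\cdot\varepsilon^{ijk}$ ($i,j,k$ being the indices on these edges), and three terminal vertices without outgoing edges, each of in-degree at least $1$ and carrying $a$. By the same rule (decorate the edges by indices, differentiate, multiply, sum over all indices, the index on the edge into the sink being the vector index) each micro-graph encodes a vector field on $\mathbb{R}^3$ with differential-polynomial coefficients. A tadpole is an edge from a vertex to itself. **Proposition.** No real linear combination $X^{\gamma_3}$ of such micro-graphs, all without tadpoles, encodes a vector field $\vec X$ solving the coboundary equation $$Q_{\gamma_3}\bigl(P(\varrho,[a])\bigr)=[\![P(\varrho,[a]),\vec X]\!]$$ as an identity of bi-vectors with differential-polynomial coefficients. Here $[\![\cdot,\cdot]\!]$ is the Schouten bracket, $[\![P,\vec X]\!]^{ij}=\sum_k\bigl(P^{kj}\,\partial_k X^i+P^{ik}\,\partial_k X^j-X^k\,\partial_k P^{ij}\bigr)$. -/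

import Mathlib

namespace NambuMicro

open MvPolynomial

/-! ### Differential polynomials in `ϱ` and `a` on `ℝ³` -/

/-- The two dependent variables: the density `ϱ` and the Casimir `a`. -/
inductive DepVar where
  | rho : DepVar
  | cas : DepVar
  deriving DecidableEq

/-- The algebra of differential polynomials over `ℝ` on `ℝ³`: the polynomial ring in the jet
variables `(u, σ)`, standing for `∂₀^{σ 0} ∂₁^{σ 1} ∂₂^{σ 2} u` with `u = ϱ` or `u = a`. -/
abbrev DiffPoly : Type := MvPolynomial (DepVar × (Fin 3 → ℕ)) ℝ

/-- The total derivative `∂_k`: the derivation with `∂_k u_σ = u_{σ + e_k}`. -/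
noncomputable def totalD (k : Fin 3) : Derivation ℝ DiffPoly DiffPoly :=
  mkDerivation ℝ fun v => X (v.1, v.2 + Pi.single k 1)

/-- The iterated total derivative `∂₀^{σ 0} ∂₁^{σ 1} ∂₂^{σ 2}`. -/
noncomputable def iterD (σ : Fin 3 → ℕ) (p : DiffPoly) : DiffPoly :=
  (totalD 0)^[σ 0] ((totalD 1)^[σ 1] ((totalD 2)^[σ 2] p))

/-- The density `ϱ`, as a differential polynomial. -/
noncomputable def rho : DiffPoly := X (DepVar.rho, 0)

/-- The Casimir `a`, as a differential polynomial. -/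
noncomputable def cas : DiffPoly := X (DepVar.cas, 0)

/-- The Levi-Civita symbol `ε^{ijk}` on `ℝ³`: the determinant of the matrix whose rows are the
standard basis vectors `e_i`, `e_j`, `e_k`. -/
noncomputable def leviCivita (i j k : Fin 3) : ℝ :=
  Matrix.det (Matrix.of fun r c : Fin 3 => if ![i, j, k] r = c then (1 : ℝ) else 0)

/-- A vector field `∑ X^i ∂_i` on `ℝ³` with differential-polynomial coefficients. -/
abbrev VectorField : Type := Fin 3 → DiffPoly

/-- The components `B^{ij}` of a bi-vector field on `ℝ³` with differential-polynomial
coefficients; the corresponding bracket is `{f, g} = ∑ B^{ij} ∂_i f ∂_j g`. -/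
abbrev BiVector : Type := Fin 3 → Fin 3 → DiffPoly

/-- The Nambu-determinant Poisson bi-vector `P(ϱ,[a])` on `ℝ³`:
`P^{jk} = ϱ ∑_i ε^{ijk} ∂_i a`. -/
noncomputable def nambu : BiVector := fun j k =>
  rho * ∑ i : Fin 3, C (leviCivita i j k) * totalD i cas

/-- The Schouten bracket `⟦B, Y⟧ = -⟦Y, B⟧ = -L_Y B` of a bi-vector field `B` with a vector
field `Y`, in components. -/
noncomputable def schouten (B : BiVector) (Y : VectorField) : BiVector := fun i j =>
  ∑ k : Fin 3, (B k j * totalD k (Y i) + B i k * totalD k (Y j) - Y k * totalD k (B i j))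

/-! ### Kontsevich graphs and the tetrahedral flow -/

/-- A Kontsevich graph on `m` ordered sinks and `n` wedges, encoding an `m`-vector: each internal
vertex has two ordered outgoing edges (`0` for Left, `1` for Right), and each sink has
in-degree one. -/
structure KontsevichGraph (m n : ℕ) where
  /-- The head of the edge number `s` issued from the internal vertex `v`. -/
  head : Fin n → Fin 2 → Fin m ⊕ Fin n
  sink_inDegree : ∀ x : Fin m,
    (Finset.univ.filter fun e : Fin n × Fin 2 => head e.1 e.2 = Sum.inl x).card = 1

/-- The component, with indices `i`, of the `m`-vector obtained by placing a copy of the bi-vector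
`B` in each internal vertex: the sum over all decorations `I` of the edges by indices, where the
edge into sink `x` carries the index `i x`, of the product over the internal vertices `v` of the
component of `B` given by the indices on the two edges issued from `v`, differentiated with respect
to the index of each edge that enters `v`. -/
noncomputable def KontsevichGraph.component {m n : ℕ} (G : KontsevichGraph m n) (B : BiVector)
    (i : Fin m → Fin 3) : DiffPoly :=
  ∑ I : Fin n → Fin 2 → Fin 3,
    if ∀ v s x, G.head v s = Sum.inl x → I v s = i x then
      ∏ v : Fin n,
        iterD (fun k => (Finset.univ.filter fun e : Fin n × Fin 2 =>
          G.head e.1 e.2 = Sum.inr v ∧ I e.1 e.2 = k).card) (B (I v 0) (I v 1))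
    else 0

/-- The graph `(0,1; 2,4; 2,5; 2,3)` on sinks `0, 1` and wedges `2, 3, 4, 5`
(the wedge tops `2, 3, 4, 5` are `Sum.inr 0, …, Sum.inr 3` here). -/
def tetraGraph₁ : KontsevichGraph 2 4 where
  head := ![![Sum.inl 0, Sum.inl 1], ![Sum.inr 0, Sum.inr 2], ![Sum.inr 0, Sum.inr 3],
    ![Sum.inr 0, Sum.inr 1]]
  sink_inDegree := by decide

/-- The graph `(0,3; 1,4; 2,5; 2,3)`. -/
def tetraGraph₂ : KontsevichGraph 2 4 where
  head := ![![Sum.inl 0, Sum.inr 1], ![Sum.inl 1, Sum.inr 2], ![Sum.inr 0, Sum.inr 3],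
    ![Sum.inr 0, Sum.inr 1]]
  sink_inDegree := by decide

/-- The graph `(0,3; 4,5; 1,2; 2,4)`. -/
def tetraGraph₃ : KontsevichGraph 2 4 where
  head := ![![Sum.inl 0, Sum.inr 1], ![Sum.inr 2, Sum.inr 3], ![Sum.inl 1, Sum.inr 0],
    ![Sum.inr 0, Sum.inr 2]]
  sink_inDegree := by decide

/-- Kontsevich's tetrahedral flow
`Q_{γ₃} = 1 · (0,1; 2,4; 2,5; 2,3) - 3 · ((0,3; 1,4; 2,5; 2,3) + (0,3; 4,5; 1,2; 2,4))`,
evaluated at a bi-vector `B`. -/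
noncomputable def tetraFlow (B : BiVector) : BiVector := fun i j =>
  tetraGraph₁.component B ![i, j]
    - 3 * (tetraGraph₂.component B ![i, j] + tetraGraph₃.component B ![i, j])

/-! ### Micro-graphs on `ℝ³` -/

/-- The vertices of a micro-graph for `d = 3`: `m` sinks, `n` trident vertices (each containing
`ϱ · ε^{ijk}`), and `n` terminal vertices (each containing the Casimir `a`). -/
inductive MicroVertex (m n : ℕ) where
  | sink : Fin m → MicroVertex m n
  | trident : Fin n → MicroVertex m n
  | terminal : Fin n → MicroVertex m n
  deriving DecidableEq

/-- A micro-graph for `d = 3`, encoding an `m`-vector: each of the `n` trident vertices has three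
ordered outgoing edges, the `n` terminal vertices have no outgoing edges and in-degree at
least one, and each of the `m` sinks has in-degree one (and no outgoing edges). -/
structure MicroGraph (m n : ℕ) where
  /-- The head of the edge number `s` issued from the trident vertex `v`. -/
  head : Fin n → Fin 3 → MicroVertex m n
  terminal_inDegree : ∀ c : Fin n,
    1 ≤ (Finset.univ.filter fun e : Fin n × Fin 3 =>
      head e.1 e.2 = MicroVertex.terminal c).card
  sink_inDegree : ∀ x : Fin m,
    (Finset.univ.filter fun e : Fin n × Fin 3 => head e.1 e.2 = MicroVertex.sink x).card = 1

namespace MicroGraph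

variable {m n : ℕ}

/-- A tadpole is a 1-cycle, that is, an edge from a vertex to itself. -/
def HasTadpole (Γ : MicroGraph m n) : Prop :=
  ∃ v s, Γ.head v s = MicroVertex.trident v

/-- Given a decoration `I` of the edges by indices, the number of edges entering the vertex `w`
that carry the index `k`. -/
def inCount (Γ : MicroGraph m n) (I : Fin n → Fin 3 → Fin 3) (w : MicroVertex m n)
    (k : Fin 3) : ℕ :=
  (Finset.univ.filter fun e : Fin n × Fin 3 => Γ.head e.1 e.2 = w ∧ I e.1 e.2 = k).card

/-- The component, with indices `i`, of the `m`-vector encoded by a micro-graph: the sum over all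
decorations `I` of the edges by indices, where the edge into sink `x` carries the index `i x`, of
the product of all vertex contents, each differentiated with respect to the index of each edge
that enters the vertex. -/
noncomputable def component (Γ : MicroGraph m n) (i : Fin m → Fin 3) : DiffPoly :=
  ∑ I : Fin n → Fin 3 → Fin 3,
    if ∀ v s x, Γ.head v s = MicroVertex.sink x → I v s = i x then
      (∏ v : Fin n, C (leviCivita (I v 0) (I v 1) (I v 2)) *
          iterD (Γ.inCount I (MicroVertex.trident v)) rho) *
        ∏ c : Fin n, iterD (Γ.inCount I (MicroVertex.terminal c)) cas
    else 0

/-- The vector field encoded by a micro-graph over one sink. -/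
noncomputable def vectorField (Γ : MicroGraph 1 n) : VectorField := fun i =>
  Γ.component fun _ => i

end MicroGraph

/-- The vector fields encoded by real linear combinations of micro-graphs without tadpoles over one
sink, with three trident vertices and three terminal vertices. -/
noncomputable def tadpoleFreeAnsatz : Submodule ℝ VectorField :=
  Submodule.span ℝ {Y | ∃ Γ : MicroGraph 1 3, ¬ Γ.HasTadpole ∧ Y = Γ.vectorField}

end NambuMicro

namespace NambuMicro

open MvPolynomial

/-! Both sides are compared at one jet: the component `0 1` at the origin for `ϱ = x² + (x¹)³ / 6`,
`a = x³`; indices run over `0, 1, 2`. There `P` vanishes and the only nonzero first derivative of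
`P⁰¹` is along index `1`, so the Schouten bracket reduces to `-Y 1` (`evalJet_schouten_nambu`). The
nonzero jets of `ϱ` have order one or three. The in-degrees in the first tetrahedral graph are `3,
1, 1, 1`, and it contributes `1`; the other two graphs have a vertex of in-degree two and contribute
`0`. So the flow equals `1` (`evalJet_tetraFlow_nambu`). For a tadpole-free micro-graph, `Y 1`
evaluates to `0`: the third derivative of `ϱ` needs an edge of index `0` from every trident,
including the one differentiated (`evalJet_vectorField_of_not_hasTadpole`). The equation would read
`1 = 0`. -/

/-- The jets at the origin of the functions `ϱ = x² + (x¹)³ / 6` and `a = x³`. -/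
noncomputable def cubicJet : DepVar × (Fin 3 → ℕ) → ℝ
  | (DepVar.rho, σ) => if σ = ![0, 1, 0] ∨ σ = ![3, 0, 0] then 1 else 0
  | (DepVar.cas, σ) => if σ = ![0, 0, 1] then 1 else 0

/-- The value of a differential polynomial on the jets `cubicJet`. -/
noncomputable def evalJet : DiffPoly →ₐ[ℝ] ℝ := aeval cubicJet

@[simp] lemma evalJet_X (v : DepVar × (Fin 3 → ℕ)) : evalJet (X v) = cubicJet v :=
  aeval_X _ _

@[simp] lemma evalJet_C (c : ℝ) : evalJet (C c) = c := aeval_C _ _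

@[simp] lemma totalD_X (k : Fin 3) (v : DepVar × (Fin 3 → ℕ)) :
    totalD k (X v) = X (v.1, v.2 + Pi.single k 1) :=
  mkDerivation_X _ _ _

/-! ### Total derivatives and the Nambu bi-vector at the chosen jet -/

/-- A relation stable under shifting a jet index by `e_k` along `totalD k` passes to `iterD`. -/
lemma iterD_induction {R : (Fin 3 → ℕ) → DiffPoly → Prop}
    (step : ∀ k τ p, R τ p → R (τ + Pi.single k 1) (totalD k p)) {p : DiffPoly} (h0 : R 0 p)
    (σ : Fin 3 → ℕ) : R σ (iterD σ p) := by
  have iter : ∀ (k : Fin 3) (n : ℕ) (τ : Fin 3 → ℕ) (q : DiffPoly), R τ q →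
      R (τ + Pi.single k n) ((totalD k)^[n] q) := by
    intro k n
    induction n with
    | zero => intro τ q h; simpa using h
    | succ n ih =>
      intro τ q h
      rw [Function.iterate_succ_apply', Pi.single_add, ← add_assoc]
      exact step _ _ _ (ih _ _ h)
  have h := iter 0 (σ 0) _ _ (iter 1 (σ 1) _ _ (iter 2 (σ 2) _ _ h0))
  have hσ : (0 : Fin 3 → ℕ) + Pi.single 2 (σ 2) + Pi.single 1 (σ 1) + Pi.single 0 (σ 0) = σ := by
    funext i
    fin_cases i <;> simp
  rwa [hσ] at h

lemma iterD_X_zero (u : DepVar) (σ : Fin 3 → ℕ) : iterD σ (X (u, 0)) = X (u, σ) :=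
  iterD_induction (R := fun τ q => q = X (u, τ)) (fun k τ q h => by rw [h, totalD_X]) rfl σ

/-- The ideal generated by the jet variables of `a` of order at least two. -/
noncomputable def higherCasIdeal : Ideal DiffPoly :=
  Ideal.span (X '' {v | v.1 = DepVar.cas ∧ 2 ≤ ∑ i, v.2 i})

/-- A total derivative only raises the order of a generator, and Leibniz's rule extends this to the
whole ideal. -/
lemma totalD_mem_higherCasIdeal (k : Fin 3) {p : DiffPoly} (hp : p ∈ higherCasIdeal) :
    totalD k p ∈ higherCasIdeal := by
  induction hp using Submodule.span_induction with
  | mem x hx =>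
    obtain ⟨v, ⟨hv, hs⟩, rfl⟩ := hx
    rw [totalD_X]
    refine Ideal.subset_span ⟨(v.1, v.2 + Pi.single k 1), ⟨hv, ?_⟩, rfl⟩
    simp only [Pi.add_apply, Finset.sum_add_distrib]
    omega
  | zero => simp
  | add x y _ _ hx hy => rw [map_add]; exact add_mem hx hy
  | smul c x hx h =>
    rw [smul_eq_mul, Derivation.leibniz, smul_eq_mul, smul_eq_mul]
    exact add_mem (Ideal.mul_mem_left _ _ h) (Ideal.mul_mem_right _ _ hx)

lemma evalJet_eq_zero_of_mem {p : DiffPoly} (hp : p ∈ higherCasIdeal) : evalJet p = 0 := by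
  have h : higherCasIdeal ≤ RingHom.ker evalJet.toRingHom := by
    rw [higherCasIdeal, Ideal.span_le]
    rintro _ ⟨⟨u, σ⟩, ⟨rfl, hs⟩, rfl⟩
    have hne : σ ≠ ![0, 0, 1] := by
      rintro rfl
      simp [Fin.sum_univ_three] at hs
    change evalJet (X (DepVar.cas, σ)) = 0
    simp [cubicJet, hne]
  exact h hp

lemma evalJet_totalD_cas (i : Fin 3) : evalJet (totalD i cas) = if i = 2 then 1 else 0 := by
  rw [cas, totalD_X, evalJet_X]
  fin_cases i <;> simp [cubicJet, funext_iff, Fin.forall_fin_succ, Pi.single_apply]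

lemma evalJet_sum_leviCivita (j k : Fin 3) :
    evalJet (∑ i : Fin 3, C (leviCivita i j k) * totalD i cas) = leviCivita 2 j k := by
  simp [evalJet_totalD_cas]

/-- On the jets `cubicJet`, where `a` is affine, only `ϱ` is affected by differentiation of the
Nambu bi-vector. -/
lemma evalJet_iterD_nambu (σ : Fin 3 → ℕ) (j k : Fin 3) :
    evalJet (iterD σ (nambu j k)) = cubicJet (DepVar.rho, σ) * leviCivita 2 j k := by
  set A : DiffPoly := ∑ i : Fin 3, C (leviCivita i j k) * totalD i cas with hA
  have hAD : ∀ l, totalD l A ∈ higherCasIdeal := by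
    intro l
    rw [hA, map_sum]
    refine sum_mem fun i _ => ?_
    rw [← smul_eq_C_mul, Derivation.map_smul, smul_eq_C_mul, cas, totalD_X, totalD_X]
    refine Ideal.mul_mem_left _ _ (Ideal.subset_span ⟨_, ⟨rfl, ?_⟩, rfl⟩)
    simp [Finset.sum_add_distrib]
  -- Modulo the ideal, `A` is constant under every total derivative, so all derivatives fall on `ϱ`.
  have h : iterD σ (nambu j k) - X (DepVar.rho, σ) * A ∈ higherCasIdeal := by
    refine iterD_induction
      (R := fun τ q => q - X (DepVar.rho, τ) * A ∈ higherCasIdeal) (fun l τ q hq => ?_) ?_ σ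
    · have h1 := totalD_mem_higherCasIdeal l hq
      rw [map_sub, Derivation.leibniz, totalD_X, smul_eq_mul, smul_eq_mul] at h1
      have h2 := add_mem h1 (Ideal.mul_mem_left _ (X (DepVar.rho, τ)) (hAD l))
      convert h2 using 1
      ring
    · simp [nambu, rho, hA]
  have h' := evalJet_eq_zero_of_mem h
  rw [map_sub, map_mul, evalJet_X, hA, evalJet_sum_leviCivita] at h'
  linarith

lemma evalJet_rho : evalJet rho = 0 := by
  simp [rho, cubicJet, funext_iff, Fin.forall_fin_succ]

lemma leviCivita_ne_zero {i j k : Fin 3} (h : leviCivita i j k ≠ 0) :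
    Function.Injective ![i, j, k] := by
  intro r s hrs
  by_contra hne
  refine h (Matrix.det_zero_of_row_eq hne ?_)
  funext c
  simp [hrs]

lemma leviCivita_two_zero_one : leviCivita 2 0 1 = 1 := by
  simp [leviCivita, Matrix.det_fin_three]

/-- Since `ϱ` vanishes at the origin, the terms that differentiate `Y` drop out; what remains is `Y`
contracted with the gradient of `P⁰¹`. -/
lemma evalJet_schouten_nambu (Y : VectorField) :
    evalJet (schouten nambu Y 0 1) = -evalJet (Y 1) := by
  have hB : ∀ j k, evalJet (nambu j k) = 0 := fun j k => by
    rw [nambu, map_mul, evalJet_rho, zero_mul]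
  have hD : ∀ k, evalJet (totalD k (nambu 0 1)) = if k = 1 then 1 else 0 := fun k => by
    rw [nambu, Derivation.leibniz, map_add, smul_eq_mul, smul_eq_mul, map_mul, map_mul,
      evalJet_sum_leviCivita, evalJet_rho, leviCivita_two_zero_one, rho, totalD_X, evalJet_X]
    fin_cases k <;> simp [cubicJet, funext_iff, Fin.forall_fin_succ, Pi.single_apply]
  simp [schouten, hB, hD]

/-! ### The tetrahedral flow -/

lemma evalJet_component_nambu {m n : ℕ} (G : KontsevichGraph m n) (i : Fin m → Fin 3) :
    evalJet (G.component nambu i) = ∑ I : Fin n → Fin 2 → Fin 3,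
      if ∀ v s x, G.head v s = Sum.inl x → I v s = i x then
        ∏ v : Fin n, cubicJet (DepVar.rho, fun k => (Finset.univ.filter fun e : Fin n × Fin 2 =>
          G.head e.1 e.2 = Sum.inr v ∧ I e.1 e.2 = k).card) * leviCivita 2 (I v 0) (I v 1)
      else 0 := by
  rw [KontsevichGraph.component, map_sum]
  refine Finset.sum_congr rfl fun I _ => ?_
  split_ifs
  · rw [map_prod]
    exact Finset.prod_congr rfl fun v _ => evalJet_iterD_nambu _ _ _
  · exact map_zero _

/-- The numbers of incoming edges with a given index add up to the in-degree. -/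
lemma sum_card_filter_index {E : Type*} [Fintype E] (p : E → Prop) [DecidablePred p]
    (I : E → Fin 3) :
    ∑ k, (Finset.univ.filter fun e => p e ∧ I e = k).card = (Finset.univ.filter p).card := by
  rw [Finset.card_eq_sum_card_fiberwise (f := I) (t := Finset.univ) (fun _ _ => Finset.mem_univ _)]
  simp only [Finset.filter_filter]

lemma cubicJet_rho_ne_zero {σ : Fin 3 → ℕ} (h : cubicJet (DepVar.rho, σ) ≠ 0) :
    σ = ![0, 1, 0] ∨ σ = ![3, 0, 0] := by
  by_contra hσ
  exact h (if_neg hσ)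

/-- The Hessian of `ϱ` vanishes at the origin, so a graph with a vertex of in-degree two does not
contribute. -/
lemma evalJet_component_eq_zero_of_inDegree_two {m n : ℕ} (G : KontsevichGraph m n)
    (i : Fin m → Fin 3) (v : Fin n)
    (hv : (Finset.univ.filter fun e : Fin n × Fin 2 => G.head e.1 e.2 = Sum.inr v).card = 2) :
    evalJet (G.component nambu i) = 0 := by
  rw [evalJet_component_nambu]
  refine Finset.sum_eq_zero fun I _ => ?_
  split_ifs
  · refine Finset.prod_eq_zero (Finset.mem_univ v) (mul_eq_zero_of_left ?_ _)
    by_contra hne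
    have hs := sum_card_filter_index (fun e : Fin n × Fin 2 => G.head e.1 e.2 = Sum.inr v)
      (fun e => I e.1 e.2)
    rw [hv, Fin.sum_univ_three] at hs
    rcases cubicJet_rho_ne_zero hne with h | h <;>
    · have h0 := congrFun h 0
      have h1 := congrFun h 1
      have h2 := congrFun h 2
      simp only [Matrix.cons_val] at h0 h1 h2
      omega
  · rfl

/-- A single decoration survives: index `0` on every Left edge and `1` on every Right edge. -/
lemma evalJet_tetraGraph₁ : evalJet (tetraGraph₁.component nambu ![0, 1]) = 1 := by
  rw [evalJet_component_nambu, Finset.sum_eq_single (fun _ => ![0, 1])]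
  · rw [if_pos (by decide), Fin.prod_univ_four]
    have h0 : (fun k => (Finset.univ.filter fun e : Fin 4 × Fin 2 =>
        tetraGraph₁.head e.1 e.2 = Sum.inr 0 ∧ (![0, 1] : Fin 2 → Fin 3) e.2 = k).card)
          = ![3, 0, 0] := by decide
    have h1 : ∀ v : Fin 4, v ≠ 0 → (fun k => (Finset.univ.filter fun e : Fin 4 × Fin 2 =>
        tetraGraph₁.head e.1 e.2 = Sum.inr v ∧ (![0, 1] : Fin 2 → Fin 3) e.2 = k).card)
          = ![0, 1, 0] := by decide
    rw [h0, h1 1 (by decide), h1 2 (by decide), h1 3 (by decide)]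
    simp [cubicJet, leviCivita_two_zero_one]
  · intro I _ hI
    split_ifs with hs
    · by_contra hne
      replace hne := Finset.prod_ne_zero_iff.1 hne
      have hr := fun v => cubicJet_rho_ne_zero (left_ne_zero_of_mul (hne v (Finset.mem_univ v)))
      have hε := fun v => leviCivita_ne_zero (right_ne_zero_of_mul (hne v (Finset.mem_univ v)))
      have hdeg : ∀ v : Fin 4, v ≠ 0 → (Finset.univ.filter fun e : Fin 4 × Fin 2 =>
          tetraGraph₁.head e.1 e.2 = Sum.inr v).card = 1 := by decide
      -- At a wedge of in-degree one the only nonzero jet of `ϱ` is `![0, 1, 0]`.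
      have hone : ∀ v s w, w ≠ 0 → tetraGraph₁.head v s = Sum.inr w → I v s = 1 := by
        intro v s w hw hvs
        have hsum := sum_card_filter_index
          (fun e : Fin 4 × Fin 2 => tetraGraph₁.head e.1 e.2 = Sum.inr w) (fun e => I e.1 e.2)
        rw [hdeg w hw, Fin.sum_univ_three] at hsum
        have hpos : 0 < (Finset.univ.filter fun e : Fin 4 × Fin 2 =>
            tetraGraph₁.head e.1 e.2 = Sum.inr w ∧ I e.1 e.2 = I v s).card :=
          Finset.card_pos.2 ⟨(v, s), by simp [hvs]⟩
        rcases hr w with h | h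
        · have h' := congrFun h (I v s)
          rw [h'] at hpos
          revert hpos
          generalize I v s = k
          fin_cases k <;> simp
        · have h0 := congrFun h 0
          simp only [Matrix.cons_val] at h0
          omega
      -- Every Right edge enters sink `1` or a wedge of in-degree one.
      have h1 : ∀ v, I v 1 = 1 := by
        intro v
        fin_cases v
        · exact hs 0 1 1 rfl
        · exact hone 1 1 2 (by decide) rfl
        · exact hone 2 1 3 (by decide) rfl
        · exact hone 3 1 1 (by decide) rfl
      refine hI (funext fun v => funext fun s => ?_)
      fin_cases s
      -- The factor `leviCivita 2 (I v 0) 1` leaves only `0` for the Left edge.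
      · have h01 := (hε v).ne (show (0 : Fin 3) ≠ 1 by decide)
        have h12 := (hε v).ne (show (1 : Fin 3) ≠ 2 by decide)
        have hv := h1 v
        simp only [Matrix.cons_val] at h01 h12
        change I v 0 = 0
        omega
      · exact h1 v
    · rfl
  · exact fun h => absurd (Finset.mem_univ _) h

lemma evalJet_tetraFlow_nambu : evalJet (tetraFlow nambu 0 1) = 1 := by
  have h2 := evalJet_component_eq_zero_of_inDegree_two tetraGraph₂ ![0, 1] 0 (by decide)
  have h3 := evalJet_component_eq_zero_of_inDegree_two tetraGraph₃ ![0, 1] 0 (by decide)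
  simp [tetraFlow, evalJet_tetraGraph₁, h2, h3]

/-! ### Micro-graphs without tadpoles -/

/-- If no edge is a tadpole, then the second component of the encoded vector field vanishes on
`cubicJet`: the three edges with index `0`, one from each trident, would all have to enter one and
the same trident. -/
lemma evalJet_vectorField_of_not_hasTadpole {Γ : MicroGraph 1 3} (hΓ : ¬ Γ.HasTadpole) :
    evalJet (Γ.vectorField 1) = 0 := by
  rw [MicroGraph.vectorField, MicroGraph.component, map_sum]
  refine Finset.sum_eq_zero fun I _ => ?_
  split_ifs with hsink
  swap
  · exact map_zero _
  by_contra hne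
  simp only [rho, cas, iterD_X_zero, map_mul, map_prod, evalJet_X, evalJet_C] at hne
  have hT := Finset.prod_ne_zero_iff.1 (left_ne_zero_of_mul hne)
  have hC := Finset.prod_ne_zero_iff.1 (right_ne_zero_of_mul hne)
  have hinj : ∀ v, Function.Injective (I v) := fun v => by
    have h := leviCivita_ne_zero (left_ne_zero_of_mul (hT v (Finset.mem_univ v)))
    convert h using 1
    funext s
    fin_cases s <;> rfl
  -- `z v` is the unique slot of trident `v` whose edge has index `0`.
  choose z hz using fun v => (Finite.surjective_of_injective (hinj v)) 0
  have hpos : 0 < Γ.inCount I (Γ.head 0 (z 0)) 0 :=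
    Finset.card_pos.2 ⟨(0, z 0), by simp [hz]⟩
  cases hw : Γ.head 0 (z 0) with
  | sink x =>
    have h := hsink _ _ _ hw
    rw [hz] at h
    exact absurd h (by decide)
  | terminal c =>
    have hc : Γ.inCount I (MicroVertex.terminal c) = ![0, 0, 1] := by
      by_contra h
      exact hC c (Finset.mem_univ c) (if_neg h)
    rw [hw, hc] at hpos
    simp at hpos
  | trident w =>
    -- An incoming index `0` rules out the jet `![0, 1, 0]`, leaving `![3, 0, 0]`.
    have h3 : Γ.inCount I (MicroVertex.trident w) 0 = 3 := by
      rw [hw] at hpos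
      rcases cubicJet_rho_ne_zero (right_ne_zero_of_mul (hT w (Finset.mem_univ w))) with h | h
      · rw [h] at hpos
        simp at hpos
      · rw [h]
        rfl
    -- There are only three edges of index `0`, one per trident, so all of them enter `w`; the one
    -- issued from `w` is a tadpole.
    have hsub : (Finset.univ.filter fun e : Fin 3 × Fin 3 =>
        Γ.head e.1 e.2 = MicroVertex.trident w ∧ I e.1 e.2 = 0) ⊆
          Finset.univ.image fun v => (v, z v) := by
      rintro ⟨v, s⟩ he
      have hs : I v s = 0 := (Finset.mem_filter.1 he).2.2
      exact Finset.mem_image.2 ⟨v, Finset.mem_univ v, by rw [hinj v (hs.trans (hz v).symm)]⟩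
    have heq := Finset.eq_of_subset_of_card_le hsub
      (Finset.card_image_le.trans (le_of_eq ((Finset.card_fin 3).trans h3.symm)))
    have hmem : (w, z w) ∈ Finset.univ.image fun v => (v, z v) :=
      Finset.mem_image_of_mem _ (Finset.mem_univ w)
    rw [← heq] at hmem
    exact hΓ ⟨w, z w, (Finset.mem_filter.1 hmem).2.1⟩

lemma evalJet_of_mem_tadpoleFreeAnsatz {Y : VectorField} (hY : Y ∈ tadpoleFreeAnsatz) :
    evalJet (Y 1) = 0 := by
  induction hY using Submodule.span_induction with
  | mem Y h =>
    obtain ⟨Γ, hΓ, rfl⟩ := h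
    exact evalJet_vectorField_of_not_hasTadpole hΓ
  | zero => exact map_zero _
  | add Y Z _ _ hY hZ => rw [Pi.add_apply, map_add, hY, hZ, add_zero]
  | smul c Y _ hY => rw [Pi.smul_apply, map_smul, hY, smul_zero]

end NambuMicro

theorem mainTheorem5 :
    ¬ ∃ Y ∈ NambuMicro.tadpoleFreeAnsatz,
      NambuMicro.tetraFlow NambuMicro.nambu =
        NambuMicro.schouten NambuMicro.nambu Y := by
  rintro ⟨Y, hY, h⟩
  have h01 := congrArg NambuMicro.evalJet (congrFun (congrFun h 0) 1)
  rw [NambuMicro.evalJet_tetraFlow_nambu, NambuMicro.evalJet_schouten_nambu,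
    NambuMicro.evalJet_of_mem_tadpoleFreeAnsatz hY, neg_zero] at h01
  exact one_ne_zero h01
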